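/- A Rokhlin tower $\mathfrak W$ of height $h\ge 1$ is a finite sequence $(I_1,\dots,I_h)$ of pairwise disjoint intervals $I_k=[c_k,c_k+w)\subset\mathbb R$ of equal length $w>0$. Write $B(\mathfrak W)=I_1$, $A(\mathfrak W)=I_h$ and $U(\mathfrak W)=\bigcup_k I_k$, and let $T_{\mathfrak W}:U(\mathfrak W)\to U(\mathfrak W)$ be the periodic map translating $I_k$ onto $I_{k+1}$ for $k<h$ and $I_h$ onto $I_1$. A mass preserving refinement $\mathfrak W'\succ\mathfrak W$ is a tower $\mathfrak W'$ such that each interval of $\mathfrak W$ is a union of intervals of $\mathfrak W'$, $A(\mathfrak W')\subset A(\mathfrak W)$, $B(\mathfrak W')\subset B(\mathfrak W)$, $T_{\mathfrak W'}=T_{\mathfrak W}$ on $U(\mathfrak W)\setminus A(\mathfrak W)$, and $U(\mathfrak W')=U(\mathfrak W)$. An odometer is the inverse limit of a sequence $(\mathfrak W_n)$ of Rokhlin towers such that each $\mathfrak W_{n+1}$ is a mass preserving refinement of $\mathfrak W_n$ and the Lebesgue measure of $A(\mathfrak W_n)$ tends to $0$: that is, a measurable transformation $R$ of $Y=\bigcup_n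 U(\mathfrak W_n)$, equipped with its Borel sets and normalized Lebesgue measure, with $R(x)=\lim_{n\to\infty}T_{\mathfrak W_n}(x)$ for almost every $x\in Y$. Let $R$ be an odometer. Let $(X,\mathcal B,m)$ be a probability space such that $\mathcal B$ contains a countable family of sets separating the points of $X$ (for example, a standard probability space), and let $T:X\to X$ be a measure preserving transformation, not necessarily invertible, which is aperiodic, i.e. $m(\{x: T^nx=x\text{ for some }n\ge1\})=0$. Then there is a set $\Omega\in\mathcal B$ with $m(\Omega)>0$ such that $R$ is a factor of the induced transformation $T_\Omega$. Here $T_\Omega(x)=T^{\varphi_\Omega(x)}(x)$ for $x\in\Omega$, where $\varphi_\Omega(x)=\min\{n\ge1:T^nx\in\Omega\}$ (finite for almost every $x\in\Omega$), and $\Omega$ carries the probability measure $m_\Omega=m(\,\cdot\mid\Omega)$. That $R$ is a factor of $T_\Omega$ means that both are probability preserving transformations and there is a measurable map $\pi:\Omega\to Y$ carrying $m_\Omega$ to the normalized Lebesgue measure on $Y$, with $\pi\circ T_\Omega=R\circ\pi$ almost everywhere. -/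

import Mathlib

open MeasureTheory Filter Topology Set

noncomputable section

/-- A column (Rokhlin tower): a nonempty finite sequence of disjoint intervals
`[left i, left i + width)` of equal positive length. -/
structure RokhlinTower where
  height : ℕ
  height_pos : 0 < height
  width : ℝ
  width_pos : 0 < width
  left : Fin height → ℝ
  disjoint : Pairwise fun i j =>
    Disjoint (Ico (left i) (left i + width)) (Ico (left j) (left j + width))

namespace RokhlinTower

/-- The intervals of the tower, from bottom to top. -/
def level (W : RokhlinTower) (i : Fin W.height) : Set ℝ :=
  Ico (W.left i) (W.left i + W.width)

/-- The base of the tower: its first interval. -/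
def base (W : RokhlinTower) : Set ℝ := W.level ⟨0, W.height_pos⟩

/-- The top of the tower: its last interval. -/
def top (W : RokhlinTower) : Set ℝ :=
  W.level ⟨W.height - 1, Nat.sub_lt W.height_pos Nat.one_pos⟩

/-- The union of the tower. -/
def union (W : RokhlinTower) : Set ℝ := ⋃ i, W.level i

open Classical in
/-- The periodic map of the tower: it translates each interval onto the next one, and the last
interval onto the first one (`finRotate` is the cyclic successor on `Fin W.height`).
Outside the union of the tower it is extended by the identity. -/
def periodicMap (W : RokhlinTower) (x : ℝ) : ℝ :=
  if h : ∃ i, x ∈ W.level i then x - W.left h.choose + W.left (finRotate W.height h.choose) else x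

theorem periodicMap_of_mem (W : RokhlinTower) {x : ℝ} {i : Fin W.height} (hx : x ∈ W.level i) :
    W.periodicMap x = x - W.left i + W.left (finRotate W.height i) := by
  have h : ∃ i, x ∈ W.level i := ⟨i, hx⟩
  have hi : h.choose = i := by
    by_contra hne
    exact Set.disjoint_left.1 (W.disjoint hne) h.choose_spec hx
  rw [periodicMap, dif_pos h, hi]

/-- The tower `W'` is a (mass preserving) refinement of the tower `W`. -/
structure Refines (W' W : RokhlinTower) : Prop where
  /-- each interval of `W` is a union of intervals of `W'` -/
  level_eq : ∀ i, ∃ s : Set (Fin W'.height), W.level i = ⋃ j ∈ s, W'.level j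
  top_subset : W'.top ⊆ W.top
  base_subset : W'.base ⊆ W.base
  map_eq : ∀ x ∈ W.union \ W.top, W'.periodicMap x = W.periodicMap x
  /-- no spacers are added -/
  union_eq : W'.union = W.union

end RokhlinTower

/-- The underlying space `⋃ n, U(W n)` of the inverse limit of a sequence of towers. -/
def towerSpace (W : ℕ → RokhlinTower) : Set ℝ := ⋃ n, (W n).union

/-- The normalized restriction of `m` to the set `Ω`, `A ↦ m (A ∩ Ω) / m Ω`, as a measure on the
subspace `Ω`. -/
def normalizedRestriction {X : Type*} [MeasurableSpace X] (m : Measure X) (Ω : Set X) :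
    Measure Ω :=
  (ProbabilityTheory.cond m Ω).comap (Subtype.val : Ω → X)

/-- `R` is an odometer, namely the inverse limit of the sequence `W`: the towers are nested by mass
preserving refinements, the measures of their tops tend to `0`, and
`R x = lim (W n).periodicMap x` for almost every `x`. -/
structure IsOdometer (W : ℕ → RokhlinTower) (R : towerSpace W → towerSpace W) : Prop where
  nested : ∀ n, (W (n + 1)).Refines (W n)
  top_tendsto : Tendsto (fun n => volume (W n).top) atTop (𝓝 0)
  measurable : Measurable R
  ae_tendsto : ∀ᵐ x : towerSpace W ∂(normalizedRestriction volume (towerSpace W)),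
    Tendsto (fun n => (W n).periodicMap (x : ℝ)) atTop (𝓝 (R x : ℝ))

/-- `T` is aperiodic: almost no point is periodic (`Function.periodicPts T` is the set of the `x`
with `T^[n] x = x` for some `n ≥ 1`). -/
def IsAperiodic {X : Type*} [MeasurableSpace X] (T : X → X) (m : Measure X) : Prop :=
  ∀ᵐ x ∂m, x ∉ Function.periodicPts T

/-- The first return time `min {n ≥ 1 : T^n x ∈ Ω}`, with value `0` if there is no return. -/
def firstReturnTime {X : Type*} (T : X → X) (Ω : Set X) (x : X) : ℕ :=
  sInf {n : ℕ | 1 ≤ n ∧ T^[n] x ∈ Ω}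

theorem iterate_firstReturnTime_mem {X : Type*} (T : X → X) (Ω : Set X) (x : Ω) :
    T^[firstReturnTime T Ω x] (x : X) ∈ Ω := by
  by_cases h : {n : ℕ | 1 ≤ n ∧ T^[n] (x : X) ∈ Ω}.Nonempty
  · exact (Nat.sInf_mem h).2
  · rw [Set.not_nonempty_iff_eq_empty] at h
    simp [firstReturnTime, h]

/-- The induced transformation `x ↦ T^{φ(x)} x` on `Ω`, where `φ` is the first return time
(a point which never returns to `Ω` is left fixed). -/
def inducedMap {X : Type*} (T : X → X) (Ω : Set X) (x : Ω) : Ω :=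
  ⟨T^[firstReturnTime T Ω x] (x : X), iterate_firstReturnTime_mem T Ω x⟩

/-- The probability preserving transformation `(Y, ν, R)` is a factor of the probability preserving
transformation `(X, μ, S)`. -/
structure IsFactorPPT {X Y : Type*} [MeasurableSpace X] [MeasurableSpace Y]
    (R : Y → Y) (ν : Measure Y) (S : X → X) (μ : Measure X) : Prop where
  prob_factor : IsProbabilityMeasure ν
  preserving_factor : MeasurePreserving R ν ν
  prob : IsProbabilityMeasure μ
  preserving : MeasurePreserving S μ μ
  exists_map : ∃ π : X → Y, MeasurePreserving π μ ν ∧ π ∘ S =ᵐ[μ] R ∘ π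

end

/-! Only the heights `H n` of the towers of the odometer matter. Refinement forces `H n ∣ H (n+1)`,
and up to null sets a point of `Y` is a compatible sequence of residues modulo `H n`, to which `R`
adds one. So it suffices to find `Ω` of positive measure with labels `f n` that grow by one modulo
`H n` at each return to `Ω` and satisfy `f (n+1) ≡ f n` modulo `H n`.

One label is refined at a time, at the cost of a small part of the domain
(`IsCyclicLabel.exists_refinement`). Given a label of order `H` on `Ω`, the return map `U`, and a
multiple `h` of `H`, aperiodicity yields a tiny set `A` inside the class of label `-1` that almost
every orbit in `Ω` meets (`exists_small_sweeping_subset`). The points whose first entrance into `A`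
occurs at a positive multiple of `h` form a base whose visits are at least `h` steps apart. Keep the
points that reach this base in fewer than `h` steps; the number of steps, read backwards, is the new
label. It is compatible with the old one because `A` lies in a single class, and the loss is at most
`h` times the measure of `A`.

`exists_compatible_cyclicLabels` iterates this with losses of total less than 1 and intersects the
domains. `IsOdometer.isFactorPPT` sends a point with labels `f n` to the common point of the
corresponding levels, which exists almost surely. -/

/-! ### First return maps -/

section ReturnMap

variable {X : Type*}

/-- The first return (or first arrival) map, defined on the whole space. -/
noncomputable def returnMap (T : X → X) (Ω : Set X) (x : X) : X := T^[firstReturnTime T Ω x] x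

theorem returnMap_mem {T : X → X} {Ω : Set X} {x : X} (hx : x ∈ Ω) : returnMap T Ω x ∈ Ω :=
  iterate_firstReturnTime_mem T Ω ⟨x, hx⟩

theorem iterate_returnMap_mem {T : X → X} {Ω : Set X} {x : X} (hx : x ∈ Ω) (k : ℕ) :
    (returnMap T Ω)^[k] x ∈ Ω := by
  induction k with
  | zero => exact hx
  | succ k ih => rw [Function.iterate_succ_apply']; exact returnMap_mem ih

theorem firstReturnTime_le {T : X → X} {Ω : Set X} {x : X} {n : ℕ} (hn : 1 ≤ n)
    (h : T^[n] x ∈ Ω) : firstReturnTime T Ω x ≤ n :=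
  Nat.sInf_le ⟨hn, h⟩

theorem firstReturnTime_spec {T : X → X} {Ω : Set X} {x : X} {n : ℕ} (hn : 1 ≤ n)
    (h : T^[n] x ∈ Ω) : 1 ≤ firstReturnTime T Ω x ∧ T^[firstReturnTime T Ω x] x ∈ Ω :=
  Nat.sInf_mem (s := {n : ℕ | 1 ≤ n ∧ T^[n] x ∈ Ω}) ⟨n, hn, h⟩

theorem notMem_of_lt_firstReturnTime {T : X → X} {Ω : Set X} {x : X} {j : ℕ} (hj : 1 ≤ j)
    (h : j < firstReturnTime T Ω x) : T^[j] x ∉ Ω :=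
  fun hmem => absurd (firstReturnTime_le hj hmem) (not_le.2 h)

theorem firstReturnTime_eq {T : X → X} {Ω : Set X} {x : X} {n : ℕ} (hn : 1 ≤ n)
    (h : T^[n] x ∈ Ω) (hmin : ∀ j, 1 ≤ j → j < n → T^[j] x ∉ Ω) :
    firstReturnTime T Ω x = n := by
  refine le_antisymm (firstReturnTime_le hn h) (not_lt.1 fun hlt => ?_)
  obtain ⟨h1, h2⟩ := firstReturnTime_spec hn h
  exact hmin _ h1 hlt h2

/-- Each iterate of the return map is an iterate of the map. -/
theorem exists_iterate_eq_iterate_returnMap (T : X → X) (Ω : Set X) (x : X) (k : ℕ) :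
    ∃ j, (returnMap T Ω)^[k] x = T^[j] x := by
  induction k with
  | zero => exact ⟨0, rfl⟩
  | succ k ih =>
    obtain ⟨j, hj⟩ := ih
    refine ⟨firstReturnTime T Ω (T^[j] x) + j, ?_⟩
    rw [Function.iterate_succ_apply', hj, returnMap, Function.iterate_add_apply]

/-- Each visit to `Ω` of a point of `Ω` is realized by an iterate of the return map to `Ω`. -/
theorem exists_iterate_returnMap_eq {T : X → X} {Ω : Set X} {x : X} (n : ℕ) (hx : x ∈ Ω)
    (hn : T^[n] x ∈ Ω) : ∃ k, (returnMap T Ω)^[k] x = T^[n] x := by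
  induction n using Nat.strong_induction_on generalizing x with
  | _ n ih =>
    rcases Nat.eq_zero_or_pos n with rfl | hpos
    · exact ⟨0, rfl⟩
    · have hle := firstReturnTime_le hpos hn
      obtain ⟨h1, h2⟩ := firstReturnTime_spec hpos hn
      have hsplit : T^[n] x = T^[n - firstReturnTime T Ω x] (returnMap T Ω x) := by
        rw [returnMap, ← Function.iterate_add_apply, Nat.sub_add_cancel hle]
      obtain ⟨k, hk⟩ := ih (n - firstReturnTime T Ω x) (by omega) h2 (hsplit ▸ hn)
      exact ⟨k + 1, by rw [Function.iterate_succ_apply, hsplit]; exact hk⟩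

/-- The first visit to a subset `Ω'` of `Ω` is the first visit along the return map to `Ω`. -/
theorem exists_iterate_returnMap_eq_first {T : X → X} {Ω Ω' : Set X} (hsub : Ω' ⊆ Ω) {x : X}
    (n : ℕ) (hx : x ∈ Ω) (hn1 : 1 ≤ n) (hn : T^[n] x ∈ Ω')
    (hmin : ∀ j, 1 ≤ j → j < n → T^[j] x ∉ Ω') :
    ∃ k, 1 ≤ k ∧ (returnMap T Ω)^[k] x = T^[n] x ∧
      ∀ j, 1 ≤ j → j < k → (returnMap T Ω)^[j] x ∉ Ω' := by
  induction n using Nat.strong_induction_on generalizing x with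
  | _ n ih =>
    have hle := firstReturnTime_le hn1 (hsub hn)
    obtain ⟨h1, h2⟩ := firstReturnTime_spec hn1 (hsub hn)
    rcases hle.eq_or_lt with heq | hlt
    · exact ⟨1, le_rfl, by rw [Function.iterate_one, returnMap, heq], fun j h h' => by omega⟩
    · have hsplit : ∀ i, T^[i] (returnMap T Ω x) = T^[i + firstReturnTime T Ω x] x := fun i => by
        rw [returnMap, ← Function.iterate_add_apply]
      obtain ⟨k, hk1, hk, hkmin⟩ := ih (n - firstReturnTime T Ω x) (by omega)
        (x := returnMap T Ω x) h2 (by omega)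
        (by rw [hsplit, Nat.sub_add_cancel hle]; exact hn)
        (fun j hj hj' => by rw [hsplit]; exact hmin _ (by omega) (by omega))
      refine ⟨k + 1, by omega, ?_, fun j hj hj' => ?_⟩
      · rw [Function.iterate_succ_apply, hk, hsplit, Nat.sub_add_cancel hle]
      · obtain ⟨i, rfl⟩ : ∃ i, j = i + 1 := ⟨j - 1, by omega⟩
        rw [Function.iterate_succ_apply]
        rcases Nat.eq_zero_or_pos i with rfl | hi
        · exact hmin _ h1 hlt
        · exact hkmin i hi (by omega)

variable [MeasurableSpace X]

theorem measurable_nat_sInf {p : ℕ → X → Prop} (hp : ∀ n, MeasurableSet {x | p n x}) :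
    Measurable fun x => sInf {n | p n x} := by
  refine measurable_of_Iio fun k => ?_
  -- The second piece accounts for the value `0` of `sInf` on the empty set.
  have : (fun x => sInf {n | p n x}) ⁻¹' Iio k =
      (⋃ n ∈ Iio k, {x | p n x}) ∪ ((⋂ n, {x | p n x}ᶜ) ∩ {_x | 0 < k}) := by
    ext x
    simp only [mem_preimage, mem_Iio, mem_union, mem_iUnion, mem_inter_iff, mem_iInter,
      mem_compl_iff, mem_ofPred_eq, exists_prop]
    by_cases h : {n | p n x}.Nonempty
    · constructor
      · exact fun hlt => Or.inl ⟨_, hlt, Nat.sInf_mem h⟩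
      · rintro (⟨n, hn, hpn⟩ | ⟨hno, -⟩)
        · exact (Nat.sInf_le hpn).trans_lt hn
        · exact absurd h.some_mem (hno _)
    · rw [Set.not_nonempty_iff_eq_empty] at h
      have hno : ∀ n, ¬ p n x := fun n hn => by
        have : n ∈ {n | p n x} := hn
        rw [h] at this; exact this
      simp [hno]
  rw [this]
  exact (MeasurableSet.biUnion (to_countable _) fun n _ => hp n).union
    ((MeasurableSet.iInter fun n => (hp n).compl).inter (MeasurableSet.const _))

theorem measurable_firstReturnTime {T : X → X} (hT : Measurable T) {Ω : Set X}
    (hΩ : MeasurableSet Ω) : Measurable (firstReturnTime T Ω) :=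
  measurable_nat_sInf fun n => (MeasurableSet.const (1 ≤ n)).inter (hT.iterate n hΩ)

theorem measurable_returnMap {T : X → X} (hT : Measurable T) {Ω : Set X}
    (hΩ : MeasurableSet Ω) : Measurable (returnMap T Ω) := by
  have h : Measurable fun p : ℕ × X => T^[p.1] p.2 :=
    measurable_from_prod_countable_right fun n => hT.iterate n
  exact h.comp ((measurable_firstReturnTime hT hΩ).prodMk measurable_id)

theorem ae_exists_return {T : X → X} {m : Measure X} [IsFiniteMeasure m]
    (hT : MeasurePreserving T m m) {Ω : Set X} (hΩ : MeasurableSet Ω) :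
    ∀ᵐ x ∂m, x ∈ Ω → ∃ n, 1 ≤ n ∧ T^[n] x ∈ Ω := by
  filter_upwards [hT.conservative.ae_mem_imp_frequently_image_mem hΩ.nullMeasurableSet]
    with x hx hmem
  obtain ⟨n, hn, h⟩ := Filter.frequently_atTop.1 (hx hmem) 1
  exact ⟨n, hn, h⟩

/-- `P k` holds the points that enter `A` at time `k + 1` after avoiding `Ω` at times `1, …, k`.
Since `P (k + 1)` is the preimage of `P k \ Ω`, the masses `m (P k ∩ Ω)` telescope and sum to at
most `m A`. -/
theorem measure_inter_preimage_returnMap_le {T : X → X} {m : Measure X} [IsFiniteMeasure m]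
    (hT : MeasurePreserving T m m) {Ω A : Set X} (hΩ : MeasurableSet Ω) (hA : MeasurableSet A) :
    m (Ω ∩ returnMap T Ω ⁻¹' A) ≤ m A := by
  set P : ℕ → Set X := fun k => {x | T^[k + 1] x ∈ A ∧ ∀ j, 1 ≤ j → j < k + 1 → T^[j] x ∉ Ω}
    with hP
  have hPm : ∀ k, MeasurableSet (P k) := fun k => by
    have : P k = T^[k + 1] ⁻¹' A ∩ ⋂ j, ⋂ (_ : 1 ≤ j), ⋂ (_ : j < k + 1), (T^[j] ⁻¹' Ω)ᶜ := by
      ext x; simp [hP]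
    rw [this]
    exact (hT.measurable.iterate _ hA).inter (MeasurableSet.iInter fun j => MeasurableSet.iInter
      fun _ => MeasurableSet.iInter fun _ => (hT.measurable.iterate j hΩ).compl)
  have hstep : ∀ k, P (k + 1) = T ⁻¹' (P k \ Ω) := fun k => by
    ext x
    simp only [hP, mem_ofPred_eq, mem_preimage, Set.mem_sdiff]
    constructor
    · rintro ⟨h1, h2⟩
      exact ⟨⟨h1, fun j hj hj' => h2 (j + 1) (by omega) (by omega)⟩, h2 1 le_rfl (by omega)⟩
    · rintro ⟨⟨h1, h2⟩, h3⟩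
      refine ⟨h1, fun j hj hj' => ?_⟩
      obtain ⟨i, rfl⟩ : ∃ i, j = i + 1 := ⟨j - 1, by omega⟩
      rcases Nat.eq_zero_or_pos i with rfl | hi
      · exact h3
      · exact h2 i hi (by omega)
  have hsum : ∀ n, m (P n) + ∑ k ∈ Finset.range n, m (P k ∩ Ω) = m A := fun n => by
    induction n with
    | zero =>
      have : P 0 = T ⁻¹' A := by
        ext x; simp only [hP, mem_ofPred_eq, mem_preimage, zero_add, Function.iterate_one]
        exact ⟨fun h => h.1, fun h => ⟨h, fun j h1 h2 => by omega⟩⟩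
      simp [this, hT.measure_preimage hA.nullMeasurableSet]
    | succ n ih =>
      rw [hstep, hT.measure_preimage ((hPm n).diff hΩ).nullMeasurableSet, Finset.sum_range_succ,
        ← ih, ← measure_inter_add_sdiff (P n) hΩ]
      ring
  have hcover : (Ω ∩ returnMap T Ω ⁻¹' A : Set X) ≤ᵐ[m] (⋃ k, P k ∩ Ω : Set X) := by
    filter_upwards [ae_exists_return hT hΩ] with x hret hx
    obtain ⟨n, hn, hmem⟩ := hret hx.1
    have h1 := (firstReturnTime_spec hn hmem).1
    refine mem_iUnion.2 ⟨firstReturnTime T Ω x - 1, ⟨?_, fun j hj hj' => ?_⟩, hx.1⟩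
    · rw [Nat.sub_add_cancel h1]; exact hx.2
    · exact notMem_of_lt_firstReturnTime hj (by omega)
  calc m (Ω ∩ returnMap T Ω ⁻¹' A) ≤ m (⋃ k, P k ∩ Ω) := measure_mono_ae hcover
    _ ≤ ∑' k, m (P k ∩ Ω) := measure_iUnion_le _
    _ ≤ m A := ENNReal.tsum_le_of_sum_range_le fun n => (hsum n).symm ▸ le_add_self

/-- The one-sided bound suffices: two finite measures of equal total mass, one dominated by the
other, coincide. -/
theorem measurePreserving_returnMap {T : X → X} {m : Measure X} [IsFiniteMeasure m]
    (hT : MeasurePreserving T m m) {Ω : Set X} (hΩ : MeasurableSet Ω) :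
    MeasurePreserving (returnMap T Ω) (m.restrict Ω) (m.restrict Ω) := by
  have hmeas := measurable_returnMap hT.measurable hΩ
  refine ⟨hmeas, Measure.eq_of_le_of_measure_univ_eq (Measure.le_iff.2 fun A hA => ?_) ?_⟩
  · rw [Measure.map_apply hmeas hA, Measure.restrict_apply (hmeas hA), Measure.restrict_apply hA]
    have : returnMap T Ω ⁻¹' A ∩ Ω = Ω ∩ returnMap T Ω ⁻¹' (A ∩ Ω) := by
      ext x
      exact ⟨fun h => ⟨h.2, h.1, returnMap_mem h.2⟩, fun h => ⟨h.2.1, h.1⟩⟩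
    rw [this]
    exact measure_inter_preimage_returnMap_le hT hΩ (hA.inter hΩ)
  · rw [Measure.map_apply hmeas MeasurableSet.univ, preimage_univ]

end ReturnMap

/-! ### Small sweeping sets -/

section Sweep

variable {X : Type*} [MeasurableSpace X]

/-- Almost every point lies in one of countably many measurable sets that are disjoint from
their preimages of order less than `N`. -/
theorem exists_cover_disjoint_preimages [MeasurableSpace.CountablySeparated X]
    {T : X → X} {m : Measure X} (hT : Measurable T) (hap : IsAperiodic T m) (N : ℕ) :
    ∃ D : ℕ → Set X, (∀ j, MeasurableSet (D j)) ∧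
      (∀ j x k, 1 ≤ k → k < N → x ∈ D j → T^[k] x ∉ D j) ∧ ∀ᵐ x ∂m, ∃ j, x ∈ D j := by
  obtain ⟨e, he, hinj⟩ := MeasurableSpace.measurable_injection_nat_bool_of_countablySeparated X
  obtain ⟨C, hC⟩ := (TopologicalSpace.countable_countableBasis (ℕ → Bool)).exists_eq_range
    (let ⟨v, hv, _⟩ := (TopologicalSpace.isBasis_countableBasis _).exists_subset_of_mem_open
      (mem_univ default) isOpen_univ; ⟨v, hv⟩)
  have hCmem : ∀ j, C j ∈ TopologicalSpace.countableBasis (ℕ → Bool) := fun j => by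
    rw [hC]; exact mem_range_self j
  refine ⟨fun j => {x | e x ∈ C j ∧ ∀ k, 1 ≤ k → k < N → e (T^[k] x) ∉ C j}, fun j => ?_, ?_, ?_⟩
  · have hCm : MeasurableSet (C j) :=
      (TopologicalSpace.isOpen_of_mem_countableBasis (hCmem j)).measurableSet
    have : {x | e x ∈ C j ∧ ∀ k, 1 ≤ k → k < N → e (T^[k] x) ∉ C j} =
        e ⁻¹' C j ∩ ⋂ k, ⋂ (_ : 1 ≤ k), ⋂ (_ : k < N), (T^[k] ⁻¹' (e ⁻¹' C j))ᶜ := by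
      ext x; simp
    beta_reduce
    rw [this]
    exact (he hCm).inter (MeasurableSet.iInter fun k => MeasurableSet.iInter
      fun _ => MeasurableSet.iInter fun _ => (hT.iterate k (he hCm)).compl)
  · exact fun j x k hk hkN hx hx' => hx.2 k hk hkN hx'.1
  · filter_upwards [hap] with x hx
    -- Since `x` is not periodic and `e` is injective, `e x` avoids a finite set of later values,
    -- and a basic open set separates it from them.
    have hopen : IsOpen ((fun k => e (T^[k] x)) '' {k | 1 ≤ k ∧ k < N})ᶜ :=
      (((finite_lt_nat N).subset fun k hk => hk.2).image _).isClosed.isOpen_compl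
    have hmem : e x ∈ ((fun k => e (T^[k] x)) '' {k | 1 ≤ k ∧ k < N})ᶜ := by
      rintro ⟨k, hk, hkx⟩
      exact hx ⟨k, hk.1, hinj hkx⟩
    obtain ⟨v, hv, hxv, hsub⟩ :=
      (TopologicalSpace.isBasis_countableBasis _).exists_subset_of_mem_open hmem hopen
    rw [hC] at hv
    obtain ⟨j, rfl⟩ := hv
    exact ⟨j, hxv, fun k hk hkN hmem' => hsub hmem' ⟨k, ⟨hk, hkN⟩, rfl⟩⟩

/-- A measurable set that is almost disjoint from its preimages of order less than `N` has measure
at most `1 / N` of the total mass. -/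
theorem nsmul_measure_le_of_disjoint_preimages {T : X → X} {m : Measure X}
    (hT : MeasurePreserving T m m) {A : Set X} (hA : MeasurableSet A) {N : ℕ}
    (hdisj : ∀ k, 1 ≤ k → k < N → ∀ᵐ x ∂m, x ∈ A → T^[k] x ∉ A) :
    N * m A ≤ m univ := by
  have hpair : ∀ i j, i < j → j < N → AEDisjoint m (T^[i] ⁻¹' A) (T^[j] ⁻¹' A) := by
    intro i j hij hj
    have h := (hT.iterate i).quasiMeasurePreserving.ae (hdisj (j - i) (by omega) (by omega))
    refine measure_mono_null (fun x hx => ?_) h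
    intro hcon
    refine hcon hx.1 ?_
    rw [← Function.iterate_add_apply, Nat.sub_add_cancel hij.le]
    exact hx.2
  have hU : m (⋃ k ∈ Finset.range N, T^[k] ⁻¹' A) = N * m A := by
    rw [measure_biUnion_finset₀]
    · simp [(hT.iterate _).measure_preimage hA.nullMeasurableSet]
    · intro i hi j hj hij
      simp only [Finset.coe_range, mem_Iio] at hi hj
      rcases hij.lt_or_gt with h | h
      · exact hpair i j h hj
      · exact (hpair j i h hi).symm
    · exact fun k _ => (hT.measurable.iterate k hA).nullMeasurableSet
  rw [← hU]
  exact measure_mono (subset_univ _)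

/-- For an aperiodic map, each measurable set `F` contains an arbitrarily small set which is hit
by almost every orbit that hits `F`. -/
theorem exists_small_sweeping_subset [MeasurableSpace.CountablySeparated X]
    {T : X → X} {m : Measure X} [IsFiniteMeasure m] (hT : MeasurePreserving T m m)
    (hap : IsAperiodic T m) {F : Set X} (hF : MeasurableSet F) {ε : ENNReal} (hε : ε ≠ 0) :
    ∃ A ⊆ F, MeasurableSet A ∧ m A ≤ ε ∧
      ∀ᵐ x ∂m, (∃ k, T^[k] x ∈ F) → ∃ k, T^[k] x ∈ A := by
  obtain ⟨N, hN0, hN⟩ : ∃ N : ℕ, N ≠ 0 ∧ m univ / ε ≤ N := by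
    obtain ⟨N, hN⟩ := ENNReal.exists_nat_gt (ENNReal.div_lt_top (measure_ne_top m univ) hε).ne
    exact ⟨N, fun h => by simp [h] at hN, hN.le⟩
  obtain ⟨D, hDm, hDdisj, hDcov⟩ := exists_cover_disjoint_preimages hT.measurable hap N
  set G : ℕ → Set X := fun j => ⋃ k, T^[k] ⁻¹' (D j ∩ F) with hG
  have hGm : ∀ j, MeasurableSet (G j) := fun j =>
    MeasurableSet.iUnion fun k => hT.measurable.iterate k ((hDm j).inter hF)
  have hGsub : ∀ j k, T^[k] ⁻¹' G j ⊆ G j := fun j k x hx => by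
    obtain ⟨t, ht⟩ := mem_iUnion.1 hx
    refine mem_iUnion.2 ⟨t + k, ?_⟩
    rw [mem_preimage, Function.iterate_add_apply]
    exact ht
  -- Each `G j` contains its preimages, which have the same finite measure, so it is invariant up to
  -- a null set.
  have hGinv : ∀ᵐ x ∂m, ∀ j k, x ∈ G j → T^[k] x ∈ G j := by
    refine ae_all_iff.2 fun j => ae_all_iff.2 fun k => ?_
    have h := ae_eq_of_subset_of_measure_ge (hGsub j k)
      ((hT.iterate k).measure_preimage (hGm j).nullMeasurableSet).ge
      (hT.measurable.iterate k (hGm j)).nullMeasurableSet (measure_ne_top m _)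
    filter_upwards [h.mem_iff] with x hx hmem
    exact hx.2 hmem
  -- An orbit that meets `F` uses only the least `j` for which it meets `D j ∩ F`. Almost surely
  -- this index does not change along the orbit, so `A` inherits from the `D j` the disjointness
  -- from its early preimages.
  set A : Set X := ⋃ j, (D j ∩ F) \ ⋃ l, ⋃ (_ : l < j), G l with hAdef
  have hAm : MeasurableSet A := MeasurableSet.iUnion fun j => ((hDm j).inter hF).diff
    (MeasurableSet.iUnion fun l => MeasurableSet.iUnion fun _ => hGm l)
  have hAmem : ∀ x, x ∈ A ↔ ∃ j, (x ∈ D j ∧ x ∈ F) ∧ ∀ l < j, x ∉ G l := fun x => by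
    simp [hAdef]
  refine ⟨A, fun x hx => ?_, hAm, ?_, ?_⟩
  · obtain ⟨j, h, -⟩ := (hAmem x).1 hx
    exact h.2
  · have h1 : N * m A ≤ m univ := by
      refine nsmul_measure_le_of_disjoint_preimages hT hAm fun k hk hkN => ?_
      filter_upwards [hGinv] with x hinv hx hx'
      obtain ⟨j, hj, hjmin⟩ := (hAmem x).1 hx
      obtain ⟨i, hi, himin⟩ := (hAmem _).1 hx'
      have hji : j ≤ i := not_lt.1 fun h => hjmin i h (mem_iUnion.2 ⟨k, hi⟩)
      have hij : i ≤ j := not_lt.1 fun h => himin j h (hinv j k (mem_iUnion.2 ⟨0, hj⟩))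
      obtain rfl := le_antisymm hij hji
      exact hDdisj i x k hk hkN hj.1 hi.1
    have hN0' : (N : ENNReal) ≠ 0 := by exact_mod_cast hN0
    have h2 : m univ ≤ N * ε := by
      by_cases htop : ε = ⊤
      · rw [htop, ENNReal.mul_top hN0']; exact le_top
      · exact (ENNReal.div_le_iff hε htop).1 hN
    exact (ENNReal.mul_le_mul_iff_right hN0' (ENNReal.natCast_ne_top N)).1 (h1.trans h2)
  · have hcov : ∀ᵐ x ∂m, ∀ k, ∃ j, T^[k] x ∈ D j :=
      ae_all_iff.2 fun k => (hT.iterate k).quasiMeasurePreserving.ae hDcov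
    filter_upwards [hcov] with x hx hhit
    obtain ⟨k, hk⟩ := hhit
    have hex : ∃ j, x ∈ G j := by
      obtain ⟨j, hj⟩ := hx k
      exact ⟨j, mem_iUnion.2 ⟨k, hj, hk⟩⟩
    classical
    obtain ⟨t, ht⟩ := mem_iUnion.1 (Nat.find_spec hex)
    exact ⟨t, (hAmem _).2 ⟨_, ht, fun l hl hmem => Nat.find_min hex hl (hGsub l t hmem)⟩⟩

end Sweep

/-! ### Cyclic towers over a sweeping set -/

section HittingBase

variable {X : Type*}

/-- The points whose orbit enters `A` for the first time at a positive multiple of `h`. -/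
def hittingBase (U : X → X) (A : Set X) (h : ℕ) : Set X :=
  {x | ∃ l, 1 ≤ l ∧ U^[l * h] x ∈ A ∧ ∀ j < l * h, U^[j] x ∉ A}

/-- After `k < h` steps `A` has not yet been entered, so the entrance time has dropped by exactly
`k` and is no longer a multiple of `h`. This needs `1 ≤ l` in `hittingBase`. -/
theorem iterate_notMem_hittingBase {U : X → X} {A : Set X} {h : ℕ} {x : X}
    (hx : x ∈ hittingBase U A h) {k : ℕ} (hk : 1 ≤ k) (hkh : k < h) :
    U^[k] x ∉ hittingBase U A h := by
  rintro ⟨l', hl', hmem', hmin'⟩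
  obtain ⟨l, hl, hmem, hmin⟩ := hx
  have hle : h ≤ l * h := Nat.le_mul_of_pos_left h hl
  simp only [← Function.iterate_add_apply] at hmem' hmin'
  have h1 : l * h ≤ l' * h + k := not_lt.1 fun hlt => hmin _ hlt hmem'
  have h2 : l' * h ≤ l * h - k := not_lt.1 fun hlt => by
    refine hmin' _ hlt ?_
    rwa [Nat.sub_add_cancel (hkh.le.trans hle)]
  have h3 : l * h = l' * h + k := by omega
  have h4 : h ∣ k := (Nat.dvd_add_right (Dvd.intro_left l' rfl)).1 (h3 ▸ Dvd.intro_left l rfl)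
  exact absurd (Nat.le_of_dvd hk h4) (not_le.2 hkh)

theorem exists_iterate_mem_hittingBase {U : X → X} {A : Set X} {h : ℕ} (hh : 0 < h) {x : X}
    (hx : ∃ k, U^[k] x ∈ A) (hlate : ∀ k < h, U^[k] x ∉ A) :
    ∃ i < h, U^[i] x ∈ hittingBase U A h := by
  classical
  set n := Nat.find hx with hn
  have hn1 : h ≤ n := not_lt.1 fun hlt => hlate n hlt (Nat.find_spec hx)
  have hdiv : n / h * h + n % h = n := Nat.div_add_mod' n h
  refine ⟨n % h, Nat.mod_lt _ hh, n / h, Nat.div_pos hn1 hh, ?_, fun j hj => ?_⟩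
  · rw [← Function.iterate_add_apply, hdiv]; exact Nat.find_spec hx
  · rw [← Function.iterate_add_apply]
    exact Nat.find_min hx (by omega)

/-- The number of steps to the next visit of the base. -/
noncomputable def stepsToBase (U : X → X) (A : Set X) (h : ℕ) (x : X) : ℕ :=
  sInf {i | U^[i] x ∈ hittingBase U A h}

/-- Base visits are at least `h` steps apart, so a visit before time `h` is the first one. -/
theorem stepsToBase_eq {U : X → X} {A : Set X} {h i : ℕ} {x : X} (hi : i < h)
    (hx : U^[i] x ∈ hittingBase U A h) : stepsToBase U A h x = i := by
  have hle : stepsToBase U A h x ≤ i := Nat.sInf_le hx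
  have hmem : U^[stepsToBase U A h x] x ∈ hittingBase U A h :=
    Nat.sInf_mem (s := {i | U^[i] x ∈ hittingBase U A h}) ⟨i, hx⟩
  rcases hle.eq_or_lt with heq | hlt
  · exact heq
  · refine absurd ?_ (iterate_notMem_hittingBase hmem (k := i - stepsToBase U A h x)
      (by omega) (by omega))
    rwa [← Function.iterate_add_apply, Nat.sub_add_cancel hle]

/-- The position in the tower over the base is a cyclic label for the visits of the tower. -/
theorem stepsToBase_next {U : X → X} {A : Set X} {h : ℕ} {x : X} {Ω : Set X}
    (hΩ : ∀ y ∈ Ω, U y ∈ Ω) (hx : x ∈ Ω)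
    (hxB : ∃ i < h, U^[i] x ∈ hittingBase U A h) {k : ℕ} (hk : 1 ≤ k)
    (hkB : ∃ i < h, U^[i] (U^[k] x) ∈ hittingBase U A h)
    (hmin : ∀ j, 1 ≤ j → j < k →
      ¬ (U^[j] x ∈ Ω ∧ ∃ i < h, U^[i] (U^[j] x) ∈ hittingBase U A h)) :
    h - 1 - stepsToBase U A h (U^[k] x) ≡ h - 1 - stepsToBase U A h x + 1 [MOD h] := by
  have hmem : ∀ j, U^[j] x ∈ Ω := fun j => by
    induction j with
    | zero => exact hx
    | succ j ih => rw [Function.iterate_succ_apply']; exact hΩ _ ih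
  obtain ⟨i, hi, hiB⟩ := hxB
  obtain ⟨i', hi', hiB'⟩ := hkB
  rw [stepsToBase_eq hi hiB, stepsToBase_eq hi' hiB']
  -- From the base, the next kept point must be at the maximal distance `h - 1`: otherwise its
  -- predecessor would already be kept, or two base visits would be too close. Away from the base,
  -- the very next point is kept, one step nearer.
  rcases Nat.eq_zero_or_pos i with rfl | hpos
  · have : i' = h - 1 := by
      by_contra hne
      rcases hk.eq_or_lt with rfl | hlt
      · refine iterate_notMem_hittingBase (k := i' + 1) hiB (by omega) (by omega) ?_
        rw [← Function.iterate_add_apply] at hiB'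
        exact hiB'
      · refine hmin (k - 1) (by omega) (by omega) ⟨hmem _, i' + 1, by omega, ?_⟩
        rw [← Function.iterate_add_apply] at hiB' ⊢
        convert hiB' using 2
        omega
    subst this
    rw [Nat.sub_self, Nat.sub_zero, Nat.sub_add_cancel (by omega)]
    exact ((Nat.modEq_zero_iff_dvd).2 dvd_rfl).symm
  · have h1 : k = 1 := by
      by_contra hne
      refine hmin 1 le_rfl (by omega) ⟨hmem 1, i - 1, by omega, ?_⟩
      rw [← Function.iterate_add_apply, Nat.sub_add_cancel hpos]
      exact hiB
    subst h1
    have h2 : i' = i - 1 := by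
      rw [← stepsToBase_eq hi' hiB']
      refine stepsToBase_eq (by omega) ?_
      rw [← Function.iterate_add_apply, Nat.sub_add_cancel hpos]
      exact hiB
    have : h - 1 - i' = h - 1 - i + 1 := by omega
    rw [this]

end HittingBase

/-! ### Cyclic labels of induced maps and their refinement -/

section CyclicLabel

variable {X : Type*} [MeasurableSpace X]

/-- The function `f`, read modulo `H`, is a factor map from the induced transformation on `Ω` to
the cyclic rotation of order `H`. -/
structure IsCyclicLabel (T : X → X) (m : Measure X) (Ω : Set X) (f : X → ℕ) (H : ℕ) : Prop where
  measurableSet : MeasurableSet Ω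
  measurable : Measurable f
  step : ∀ᵐ x ∂m, x ∈ Ω → f (returnMap T Ω x) ≡ f x + 1 [MOD H]

theorem IsCyclicLabel.iterate {T : X → X} {m : Measure X} [IsFiniteMeasure m]
    (hT : MeasurePreserving T m m) {Ω : Set X} {f : X → ℕ} {H : ℕ}
    (hf : IsCyclicLabel T m Ω f H) :
    ∀ᵐ x ∂m, x ∈ Ω → ∀ k, f ((returnMap T Ω)^[k] x) ≡ f x + k [MOD H] := by
  have hU := measurePreserving_returnMap hT hf.measurableSet
  have h := (ae_restrict_iff' hf.measurableSet).2 hf.step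
  have h' : ∀ᵐ x ∂m.restrict Ω, ∀ k, f (returnMap T Ω ((returnMap T Ω)^[k] x)) ≡
      f ((returnMap T Ω)^[k] x) + 1 [MOD H] :=
    ae_all_iff.2 fun k => (hU.iterate k).quasiMeasurePreserving.ae h
  refine (ae_restrict_iff' hf.measurableSet).1 ?_
  filter_upwards [h'] with x hx k
  induction k with
  | zero => rfl
  | succ k ih =>
    rw [Function.iterate_succ_apply', ← add_assoc]
    exact (hx k).trans (ih.add_right 1)

theorem measurableSet_hittingBase {U : X → X} (hU : Measurable U) {A : Set X}
    (hA : MeasurableSet A) (h : ℕ) : MeasurableSet (hittingBase U A h) := by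
  have : hittingBase U A h = ⋃ l, ⋃ (_ : 1 ≤ l), U^[l * h] ⁻¹' A ∩
      ⋂ j, ⋂ (_ : j < l * h), (U^[j] ⁻¹' A)ᶜ := by
    ext x; simp [hittingBase, and_left_comm]
  rw [this]
  exact MeasurableSet.iUnion fun l => MeasurableSet.iUnion fun _ =>
    (hU.iterate _ hA).inter (MeasurableSet.iInter fun j => MeasurableSet.iInter
      fun _ => (hU.iterate j hA).compl)

/-- A cyclic label of order `H` can be refined to a cyclic label of any multiple order on a
slightly smaller set. -/
theorem IsCyclicLabel.exists_refinement [MeasurableSpace.CountablySeparated X]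
    {T : X → X} {m : Measure X} [IsFiniteMeasure m] (hT : MeasurePreserving T m m)
    (hap : IsAperiodic T m) {Ω : Set X} {f : X → ℕ} {H h : ℕ} (hf : IsCyclicLabel T m Ω f H)
    (hH : 0 < H) (hh : 0 < h) (hdvd : H ∣ h) {ε : ENNReal} (hε : ε ≠ 0) :
    ∃ Ω' ⊆ Ω, ∃ f' : X → ℕ, IsCyclicLabel T m Ω' f' h ∧ m (Ω \ Ω') ≤ ε ∧
      ∀ᵐ x ∂m, x ∈ Ω' → f' x ≡ f x [MOD H] := by
  have hΩ := hf.measurableSet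
  have hlab := hf.iterate hT
  have hUm := measurable_returnMap hT.measurable hΩ
  have hUp := measurePreserving_returnMap hT hΩ
  set U := returnMap T Ω with hUdef
  set F : Set X := Ω ∩ {x | f x + 1 ≡ 0 [MOD H]} with hF
  have hFm : MeasurableSet F :=
    hΩ.inter (hf.measurable (MeasurableSet.of_discrete (s := {k | k + 1 ≡ 0 [MOD H]})))
  obtain ⟨A, hAF, hAm, hAε, hsweep⟩ := exists_small_sweeping_subset hT hap hFm
    (ENNReal.div_ne_zero.2 ⟨hε, ENNReal.natCast_ne_top h⟩ : ε / h ≠ 0)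
  have hsweepU : ∀ᵐ x ∂m, x ∈ Ω → ∃ k, U^[k] x ∈ A := by
    filter_upwards [hsweep, hlab] with x hx hlx hxΩ
    -- The exponent makes the label plus one congruent to `(f x + 1) * H`.
    have hit : U^[f x * (H - 1) + (H - 1)] x ∈ F := by
      refine ⟨iterate_returnMap_mem hxΩ _, ?_⟩
      refine ((hlx hxΩ _).add_right 1).trans ((Nat.modEq_zero_iff_dvd).2 ⟨f x + 1, ?_⟩)
      obtain ⟨H', rfl⟩ : ∃ H', H = H' + 1 := ⟨H - 1, by omega⟩
      simp only [Nat.add_sub_cancel]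
      ring
    -- Sweeping is known along `T`-orbits; as `A ⊆ Ω`, the visit to `A` is also an iterate of `U`.
    obtain ⟨j, hj⟩ := exists_iterate_eq_iterate_returnMap T Ω x (f x * (H - 1) + (H - 1))
    obtain ⟨k, hk⟩ := hx ⟨j, by rw [← hj]; exact hit⟩
    obtain ⟨i, hi⟩ := exists_iterate_returnMap_eq k hxΩ (hAF hk).1
    exact ⟨i, by rw [hUdef, hi]; exact hk⟩
  set B := hittingBase U A h with hB
  have hBm : MeasurableSet B := measurableSet_hittingBase hUm hAm h
  set Ω' : Set X := Ω ∩ {x | ∃ i < h, U^[i] x ∈ B} with hΩ'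
  have hΩ'm : MeasurableSet Ω' := by
    have : {x | ∃ i < h, U^[i] x ∈ B} = ⋃ i, ⋃ (_ : i < h), U^[i] ⁻¹' B := by ext x; simp
    rw [hΩ', this]
    exact hΩ.inter (MeasurableSet.iUnion fun i => MeasurableSet.iUnion
      fun _ => hUm.iterate i hBm)
  refine ⟨Ω', inter_subset_left, fun x => h - 1 - stepsToBase U A h x, ⟨hΩ'm, ?_, ?_⟩, ?_, ?_⟩
  · exact (measurable_of_countable fun k : ℕ => h - 1 - k).comp
      (measurable_nat_sInf fun i => hUm.iterate i hBm)
  · filter_upwards [ae_exists_return hT hΩ'm] with x hret hx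
    obtain ⟨n, hn, hmem⟩ := hret hx
    obtain ⟨h1, h2⟩ := firstReturnTime_spec hn hmem
    obtain ⟨k, hk1, hk, hkmin⟩ := exists_iterate_returnMap_eq_first
      (inter_subset_left : Ω' ⊆ Ω) _ hx.1 h1 h2
      (fun j hj hj' => notMem_of_lt_firstReturnTime hj hj')
    have hk' : returnMap T Ω' x = U^[k] x := hk.symm
    rw [← hk, ← hUdef] at h2
    rw [hk']
    exact stepsToBase_next (fun y hy => returnMap_mem hy) hx.1 hx.2 hk1 h2.2 hkmin
  · have hsub : (Ω \ Ω' : Set X) ≤ᵐ[m] (⋃ k ∈ Finset.range h, U^[k] ⁻¹' A ∩ Ω : Set X) := by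
      filter_upwards [hsweepU] with x hx hxd
      by_contra hcon
      refine hxd.2 ⟨hxd.1, exists_iterate_mem_hittingBase hh (hx hxd.1) fun k hk hmem => hcon ?_⟩
      exact mem_iUnion₂.2 ⟨k, Finset.mem_range.2 hk, hmem, hxd.1⟩
    have hA' : ∀ k, m (U^[k] ⁻¹' A ∩ Ω) ≤ ε / h := fun k => by
      rw [← Measure.restrict_apply (hUm.iterate k hAm),
        (hUp.iterate k).measure_preimage hAm.nullMeasurableSet]
      exact (Measure.restrict_apply_le _ _).trans hAε
    calc m (Ω \ Ω') ≤ m (⋃ k ∈ Finset.range h, U^[k] ⁻¹' A ∩ Ω) := measure_mono_ae hsub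
      _ ≤ ∑ k ∈ Finset.range h, m (U^[k] ⁻¹' A ∩ Ω) := measure_biUnion_finset_le _ _
      _ ≤ ∑ k ∈ Finset.range h, ε / h := Finset.sum_le_sum fun k _ => hA' k
      _ = h * (ε / h) := by simp
      _ ≤ ε := ENNReal.mul_div_le
  · filter_upwards [hlab] with x hlx hx
    obtain ⟨hxΩ, i, hi, hiB⟩ := hx
    rw [stepsToBase_eq hi hiB]
    obtain ⟨l, -, hmem, -⟩ := hiB
    rw [← Function.iterate_add_apply] at hmem
    -- The visit to `A` at time `l * h + i` has old label `-1`, and `H ∣ h`, so the old label of `x`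
    -- is `-1 - i`, as is the new one.
    have h1 : f x + (l * h + i) + 1 ≡ 0 [MOD H] :=
      ((hlx hxΩ _).add_right 1).symm.trans (hAF hmem).2
    have h2 : l * h ≡ 0 [MOD H] := (Nat.modEq_zero_iff_dvd).2 (hdvd.mul_left l)
    have h3 : h - 1 - i + (i + 1) ≡ 0 [MOD H] := by
      rw [show h - 1 - i + (i + 1) = h by omega]
      exact (Nat.modEq_zero_iff_dvd).2 hdvd
    have h4 : f x + (i + 1) ≡ 0 [MOD H] := by
      have h5 := (Nat.ModEq.refl (f x + (i + 1))).add h2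
      rw [show f x + (i + 1) + l * h = f x + (l * h + i) + 1 by ring] at h5
      exact h5.symm.trans h1
    exact Nat.ModEq.add_right_cancel' (i + 1) (h3.trans h4.symm)

/-- For an aperiodic map and a sequence of natural numbers, each dividing the next one, there is a
set of positive measure whose induced transformation has a compatible sequence of cyclic
factors of these orders. -/
theorem exists_compatible_cyclicLabels [MeasurableSpace.CountablySeparated X]
    {T : X → X} {m : Measure X} [IsProbabilityMeasure m] (hT : MeasurePreserving T m m)
    (hap : IsAperiodic T m) {H : ℕ → ℕ} (hH : ∀ n, 0 < H n) (hdvd : ∀ n, H n ∣ H (n + 1)) :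
    ∃ Ω : Set X, MeasurableSet Ω ∧ 0 < m Ω ∧ ∃ f : ℕ → X → ℕ,
      (∀ n, IsCyclicLabel T m Ω (f n) (H n)) ∧
      ∀ n, ∀ᵐ x ∂m, x ∈ Ω → f (n + 1) x ≡ f n x [MOD H n] := by
  obtain ⟨ε, hε0, hε⟩ := ENNReal.exists_pos_sum_of_countable' (ε := 1) one_ne_zero ℕ
  have hstart : IsCyclicLabel T m univ (fun _ => 0) 1 :=
    ⟨MeasurableSet.univ, measurable_const, Eventually.of_forall fun x _ => Nat.modEq_one⟩
  obtain ⟨Ω₀, -, f₀, hf₀, hm₀, -⟩ :=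
    hstart.exists_refinement hT hap one_pos (hH 0) (one_dvd _) (hε0 0).ne'
  choose! Ωs hΩs fs hfs hms hcs using
    fun (n : ℕ) (p : Set X × (X → ℕ)) (hp : IsCyclicLabel T m p.1 p.2 (H n)) =>
      hp.exists_refinement hT hap (hH n) (hH (n + 1)) (hdvd n) (hε0 (n + 1)).ne'
  set S : ℕ → Set X × (X → ℕ) := fun n => Nat.rec (Ω₀, f₀) (fun n p => (Ωs n p, fs n p)) n with hS
  have hSlab : ∀ n, IsCyclicLabel T m (S n).1 (S n).2 (H n) := fun n => by
    induction n with
    | zero => exact hf₀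
    | succ n ih => exact hfs n (S n) ih
  have hSanti : Antitone fun n => (S n).1 := antitone_nat_of_succ_le fun n => hΩs n (S n) (hSlab n)
  have hSloss : ∀ n, m (S n).1ᶜ ≤ ∑ k ∈ Finset.range (n + 1), ε k := fun n => by
    induction n with
    | zero =>
      rw [zero_add, Finset.sum_range_one, compl_eq_univ_sdiff]
      exact hm₀
    | succ n ih =>
      rw [Finset.sum_range_succ]
      refine (measure_mono fun x hx => ?_).trans ((measure_union_le (S n).1ᶜ
        ((S n).1 \ (S (n + 1)).1)).trans (add_le_add ih (hms n (S n) (hSlab n))))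
      by_cases h : x ∈ (S n).1
      · exact Or.inr ⟨h, hx⟩
      · exact Or.inl h
  have hcompat : ∀ n k, ∀ᵐ x ∂m, x ∈ (S (n + k)).1 → (S (n + k)).2 x ≡ (S n).2 x [MOD H n] := by
    intro n k
    induction k with
    | zero => exact Eventually.of_forall fun x _ => rfl
    | succ k ih =>
      filter_upwards [ih, hcs (n + k) (S (n + k)) (hSlab _)] with x h1 h2 hx
      have hdk : H n ∣ H (n + k) := Nat.le_induction dvd_rfl
        (fun j _ hj => hj.trans (hdvd j)) (n + k) (Nat.le_add_right n k)
      exact ((h2 hx).of_dvd hdk).trans (h1 (hSanti (Nat.le_succ _) hx))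
  set Ω : Set X := ⋂ n, (S n).1 with hΩ
  have hΩm : MeasurableSet Ω := MeasurableSet.iInter fun n => (hSlab n).measurableSet
  have hΩsub : ∀ n, Ω ⊆ (S n).1 := fun n => iInter_subset _ n
  have hΩc : m Ωᶜ < 1 := by
    rw [hΩ, compl_iInter]
    have hmono : Monotone fun n => (S n).1ᶜ := fun i j hij => compl_subset_compl.2 (hSanti hij)
    rw [hmono.measure_iUnion]
    exact (iSup_le fun n => (hSloss n).trans (ENNReal.sum_le_tsum _)).trans_lt hε
  refine ⟨Ω, hΩm, ?_, fun n => (S n).2, fun n => ⟨hΩm, (hSlab n).measurable, ?_⟩, fun n => ?_⟩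
  · rw [prob_compl_eq_one_sub hΩm] at hΩc
    by_contra h0
    rw [not_lt, nonpos_iff_eq_zero] at h0
    simp [h0] at hΩc
  · have hc := ae_all_iff.2 (hcompat n)
    have hUp := measurePreserving_returnMap hT hΩm
    have hc' : ∀ᵐ x ∂m, x ∈ Ω → ∀ k, returnMap T Ω x ∈ (S (n + k)).1 →
        (S (n + k)).2 (returnMap T Ω x) ≡ (S n).2 (returnMap T Ω x) [MOD H n] :=
      (ae_restrict_iff' hΩm).1 (hUp.quasiMeasurePreserving.ae (ae_restrict_of_ae hc))
    have hst := ae_all_iff.2 fun k => (hSlab k).step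
    filter_upwards [hc, hc', hst, ae_exists_return hT hΩm] with x h1 h2 h3 hret hx
    obtain ⟨N, hN1, hN⟩ := hret hx
    obtain ⟨hφ1, hφ⟩ := firstReturnTime_spec hN1 hN
    set φ := firstReturnTime T Ω x with hφdef
    -- Each of the finitely many times before the return to `Ω` lies outside some stage. A late
    -- enough stage excludes them all, so its return map agrees with that of `Ω` at `x`; the sum `k`
    -- merely bounds every `K j`.
    have hout : ∀ j, 1 ≤ j → j < φ → ∃ k, T^[j] x ∉ (S k).1 := fun j hj hj' => by
      by_contra! hcon
      exact notMem_of_lt_firstReturnTime hj hj' (mem_iInter.2 hcon)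
    choose! K hK using hout
    set k := ∑ j ∈ Finset.range φ, K j with hk
    have hret' : returnMap T (S (n + k)).1 x = returnMap T Ω x := by
      have : firstReturnTime T (S (n + k)).1 x = φ := by
        refine firstReturnTime_eq hφ1 (hΩsub _ hφ) fun j hj hj' hmem => hK j hj hj' ?_
        refine hSanti ?_ hmem
        exact (Finset.single_le_sum (f := K) (fun _ _ => Nat.zero_le _)
          (Finset.mem_range.2 hj')).trans (Nat.le_add_left _ _)
      rw [returnMap, this, returnMap]
    have hdk : H n ∣ H (n + k) := Nat.le_induction dvd_rfl
      (fun j _ hj => hj.trans (hdvd j)) (n + k) (Nat.le_add_right n k)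
    have h4 := (h3 (n + k) (hΩsub _ hx)).of_dvd hdk
    rw [hret'] at h4
    exact ((h2 hx k (hΩsub _ hφ)).symm.trans h4).trans ((h1 k (hΩsub _ hx)).add_right 1)
  · filter_upwards [hcompat n 1] with x h1 hx
    exact h1 (hΩsub (n + 1) hx)

end CyclicLabel

/-! ### Rokhlin towers and their refinements -/

theorem val_finRotate {n : ℕ} (i : Fin n) : (finRotate n i : ℕ) = (i + 1) % n := by
  cases n with
  | zero => exact i.elim0
  | succ n => rw [finRotate_apply, Fin.val_add, Fin.val_one', Nat.add_mod_mod]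

namespace RokhlinTower

theorem left_mem_level (W : RokhlinTower) (i : Fin W.height) : W.left i ∈ W.level i :=
  ⟨le_rfl, lt_add_of_pos_right _ W.width_pos⟩

theorem eq_of_mem_level (W : RokhlinTower) {x : ℝ} {i j : Fin W.height} (hi : x ∈ W.level i)
    (hj : x ∈ W.level j) : i = j := by
  by_contra hne
  exact Set.disjoint_left.1 (W.disjoint hne) hi hj

theorem periodicMap_mem_level (W : RokhlinTower) {x : ℝ} {i : Fin W.height}
    (hx : x ∈ W.level i) : W.periodicMap x ∈ W.level (finRotate W.height i) := by
  rw [W.periodicMap_of_mem hx]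
  obtain ⟨h1, h2⟩ := hx
  constructor <;> linarith

theorem measurableSet_level (W : RokhlinTower) (i : Fin W.height) : MeasurableSet (W.level i) :=
  measurableSet_Ico

theorem volume_level (W : RokhlinTower) (i : Fin W.height) :
    volume (W.level i) = ENNReal.ofReal W.width := by
  rw [level, Real.volume_Ico, add_sub_cancel_left]

theorem volume_union (W : RokhlinTower) :
    volume W.union = W.height * ENNReal.ofReal W.width := by
  have hd : Pairwise fun i j => Disjoint (W.level i) (W.level j) := W.disjoint
  rw [union, measure_iUnion hd W.measurableSet_level, tsum_fintype]
  simp [volume_level]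

theorem measurableSet_union (W : RokhlinTower) : MeasurableSet W.union :=
  MeasurableSet.iUnion W.measurableSet_level

theorem Refines.exists_level_subset {W' W : RokhlinTower} (h : W'.Refines W)
    (j : Fin W'.height) : ∃ i, W'.level j ⊆ W.level i := by
  have hx : W'.left j ∈ W.union := h.union_eq ▸ mem_iUnion.2 ⟨j, W'.left_mem_level j⟩
  obtain ⟨i, hi⟩ := mem_iUnion.1 hx
  obtain ⟨s, hs⟩ := h.level_eq i
  refine ⟨i, ?_⟩
  rw [hs] at hi ⊢
  obtain ⟨k, hk, hkx⟩ := mem_iUnion₂.1 hi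
  rw [W'.eq_of_mem_level (W'.left_mem_level j) hkx]
  exact subset_biUnion_of_mem (u := fun j => W'.level j) hk

/-- Below the top of `W` this is `map_eq`. At the top, where `map_eq` is silent, the cyclic order
decides: every other level of `W` is already reached from its own predecessor, and each level of
`W'` has only one predecessor. -/
theorem Refines.level_finRotate_subset {W' W : RokhlinTower} (h : W'.Refines W)
    {j : Fin W'.height} {i : Fin W.height} (hji : W'.level j ⊆ W.level i) :
    W'.level (finRotate _ j) ⊆ W.level (finRotate _ i) := by
  obtain ⟨i', hi'⟩ := h.exists_level_subset (finRotate _ j)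
  suffices i' = finRotate _ i by rwa [← this]
  obtain ⟨k, rfl⟩ := (finRotate W.height).surjective i'
  set last : Fin W.height := ⟨W.height - 1, Nat.sub_lt W.height_pos Nat.one_pos⟩
  have hnottop : ∀ {l x}, l ≠ last → x ∈ W.level l →
      W'.periodicMap x = W.periodicMap x := fun {l x} hl hx =>
    h.map_eq x ⟨mem_iUnion.2 ⟨l, hx⟩, fun htop => hl (W.eq_of_mem_level hx htop)⟩
  by_cases hi : i = last
  · by_cases hk : k = last
    · rw [hi, hk]
    · set y := W'.left (finRotate _ j) with hy
      have hyl := W'.left_mem_level (finRotate _ j)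
      rw [← hy] at hyl
      have hyk := hi' hyl
      set x := y - W.left (finRotate _ k) + W.left k with hxdef
      have hxk : x ∈ W.level k := by
        obtain ⟨h1, h2⟩ := hyk
        constructor <;> linarith
      have hTx : W'.periodicMap x = y := by
        rw [hnottop hk hxk, W.periodicMap_of_mem hxk, hxdef]; ring
      have hxU : x ∈ W'.union := h.union_eq.symm ▸ mem_iUnion.2 ⟨k, hxk⟩
      obtain ⟨l, hl⟩ := mem_iUnion.1 hxU
      have h1 := W'.periodicMap_mem_level hl
      rw [hTx] at h1
      have h2 := (finRotate _).injective (W'.eq_of_mem_level h1 hyl)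
      rw [W.eq_of_mem_level hxk (hji (h2 ▸ hl))]
  · have hx := W'.left_mem_level j
    have h1 := W.periodicMap_mem_level (hji hx)
    have h2 := hi' (W'.periodicMap_mem_level hx)
    rw [hnottop hi (hji hx)] at h2
    exact W.eq_of_mem_level h2 h1

/-- The left endpoint of the level whose index is `k` modulo the height. -/
def leftMod (W : RokhlinTower) (k : ℕ) : ℝ := W.left ⟨k % W.height, Nat.mod_lt _ W.height_pos⟩

/-- The level whose index is `k` modulo the height. -/
def levelMod (W : RokhlinTower) (k : ℕ) : Set ℝ :=
  W.level ⟨k % W.height, Nat.mod_lt _ W.height_pos⟩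

theorem levelMod_eq_Ico (W : RokhlinTower) (k : ℕ) :
    W.levelMod k = Ico (W.leftMod k) (W.leftMod k + W.width) := rfl

theorem leftMod_mem_levelMod (W : RokhlinTower) (k : ℕ) : W.leftMod k ∈ W.levelMod k :=
  W.left_mem_level _

theorem measurableSet_levelMod (W : RokhlinTower) (k : ℕ) : MeasurableSet (W.levelMod k) :=
  W.measurableSet_level _

theorem levelMod_congr (W : RokhlinTower) {k l : ℕ} (h : k ≡ l [MOD W.height]) :
    W.levelMod k = W.levelMod l := by
  have h' : k % W.height = l % W.height := h
  simp only [levelMod, h']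

theorem modEq_of_mem_levelMod (W : RokhlinTower) {x : ℝ} {k l : ℕ} (hk : x ∈ W.levelMod k)
    (hl : x ∈ W.levelMod l) : k ≡ l [MOD W.height] :=
  Fin.ext_iff.1 (W.eq_of_mem_level hk hl)

theorem levelMod_subset_union (W : RokhlinTower) (k : ℕ) : W.levelMod k ⊆ W.union :=
  subset_iUnion W.level _

theorem exists_mem_levelMod (W : RokhlinTower) {x : ℝ} (hx : x ∈ W.union) :
    ∃ k, x ∈ W.levelMod k := by
  obtain ⟨i, hi⟩ := mem_iUnion.1 hx
  refine ⟨i, ?_⟩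
  simpa only [levelMod, Nat.mod_eq_of_lt i.isLt] using hi

theorem periodicMap_mem_levelMod (W : RokhlinTower) {x : ℝ} {k : ℕ} (hx : x ∈ W.levelMod k) :
    W.periodicMap x ∈ W.levelMod (k + 1) := by
  have h := W.periodicMap_mem_level hx
  have h1 : finRotate W.height ⟨k % W.height, Nat.mod_lt _ W.height_pos⟩ =
      ⟨(k + 1) % W.height, Nat.mod_lt _ W.height_pos⟩ :=
    Fin.ext ((val_finRotate _).trans (Nat.mod_add_mod k W.height 1))
  rwa [h1] at h

theorem Refines.level_subset_levelMod {W' W : RokhlinTower} (h : W'.Refines W) (k : ℕ)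
    (hk : k < W'.height) : W'.level ⟨k, hk⟩ ⊆ W.levelMod k := by
  induction k with
  | zero =>
    have := h.base_subset
    simpa only [levelMod, Nat.zero_mod, base] using this
  | succ k ih =>
    have h1 := h.level_finRotate_subset (ih (by omega))
    have h2 : finRotate W'.height ⟨k, by omega⟩ = ⟨k + 1, hk⟩ :=
      Fin.ext ((val_finRotate _).trans (Nat.mod_eq_of_lt hk))
    have h3 : finRotate W.height ⟨k % W.height, Nat.mod_lt _ W.height_pos⟩ =
        ⟨(k + 1) % W.height, Nat.mod_lt _ W.height_pos⟩ :=
      Fin.ext ((val_finRotate _).trans (Nat.mod_add_mod k W.height 1))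
    rwa [h2, h3] at h1

/-- Climbing `W'` from its base runs cyclically through `W`, and the top of `W'` must land in the
top of `W`. -/
theorem Refines.height_dvd {W' W : RokhlinTower} (h : W'.Refines W) : W.height ∣ W'.height := by
  have hpos := W'.height_pos
  have hlt : W'.height - 1 < W'.height := by omega
  have hx := W'.left_mem_level ⟨W'.height - 1, hlt⟩
  have h1 := W.eq_of_mem_level (h.level_subset_levelMod _ hlt hx) (h.top_subset hx)
  have h2 : W'.height - 1 ≡ W.height - 1 [MOD W.height] :=
    (Fin.ext_iff.1 h1).trans (Nat.mod_eq_of_lt (Nat.sub_lt W.height_pos Nat.one_pos)).symm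
  have h3 := h2.add_right 1
  rw [Nat.sub_add_cancel hpos, Nat.sub_add_cancel W.height_pos] at h3
  exact (Nat.modEq_zero_iff_dvd).1 (h3.trans ((Nat.modEq_zero_iff_dvd).2 dvd_rfl))

theorem Refines.levelMod_subset {W' W : RokhlinTower} (h : W'.Refines W) (k : ℕ) :
    W'.levelMod k ⊆ W.levelMod k := by
  have h1 := h.level_subset_levelMod (k % W'.height) (Nat.mod_lt _ W'.height_pos)
  rwa [W.levelMod_congr ((Nat.mod_modEq k W'.height).of_dvd h.height_dvd)] at h1

end RokhlinTower

/-! ### Normalized restrictions and the induced transformation -/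

section NormalizedRestriction

variable {X : Type*} [MeasurableSpace X] {m : Measure X} {Ω : Set X}

theorem normalizedRestriction_preimage (hΩ : MeasurableSet Ω) (A : Set X) :
    normalizedRestriction m Ω ((↑) ⁻¹' A : Set Ω) = (m Ω)⁻¹ * m (Ω ∩ A) := by
  rw [normalizedRestriction, (MeasurableEmbedding.subtype_coe hΩ).comap_apply,
    Subtype.image_preimage_coe, ProbabilityTheory.cond_apply hΩ, ← inter_assoc, inter_self]

theorem isProbabilityMeasure_normalizedRestriction (hΩ : MeasurableSet Ω) (h0 : m Ω ≠ 0)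
    (htop : m Ω ≠ ⊤) : IsProbabilityMeasure (normalizedRestriction m Ω) := by
  refine ⟨?_⟩
  have h := normalizedRestriction_preimage (m := m) hΩ univ
  rwa [preimage_univ, inter_univ, ENNReal.inv_mul_cancel h0 htop] at h

theorem ae_normalizedRestriction (hΩ : MeasurableSet Ω) {p : X → Prop}
    (hp : ∀ᵐ x ∂m, x ∈ Ω → p x) : ∀ᵐ x : Ω ∂normalizedRestriction m Ω, p x := by
  have h := normalizedRestriction_preimage (m := m) hΩ {x | ¬ p x}
  have h0 : m (Ω ∩ {x | ¬ p x}) = 0 :=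
    measure_mono_null (fun x hx (hcon : x ∈ Ω → p x) => hx.2 (hcon hx.1)) (ae_iff.1 hp)
  rw [h0, mul_zero] at h
  exact ae_iff.2 h

theorem measurePreserving_inducedMap [IsFiniteMeasure m] {T : X → X}
    (hT : MeasurePreserving T m m) (hΩ : MeasurableSet Ω) :
    MeasurePreserving (inducedMap T Ω) (normalizedRestriction m Ω)
      (normalizedRestriction m Ω) := by
  have hr := measurable_returnMap hT.measurable hΩ
  have hmeas : Measurable (inducedMap T Ω) :=
    (hr.comp measurable_subtype_coe).subtype_mk
  refine ⟨hmeas, Measure.ext fun s hs => ?_⟩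
  obtain ⟨A, hA, rfl⟩ := hs
  rw [Measure.map_apply hmeas (measurable_subtype_coe hA)]
  have hpre : inducedMap T Ω ⁻¹' ((↑) ⁻¹' A) = ((↑) ⁻¹' (returnMap T Ω ⁻¹' A) : Set Ω) := rfl
  rw [hpre, normalizedRestriction_preimage hΩ, normalizedRestriction_preimage hΩ, inter_comm Ω,
    inter_comm Ω, ← Measure.restrict_apply (hr hA), ← Measure.restrict_apply hA,
    (measurePreserving_returnMap hT hΩ).measure_preimage hA.nullMeasurableSet]

end NormalizedRestriction

/-! ### Nested sequences of towers -/

section NestedTowers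

variable {W : ℕ → RokhlinTower}

theorem union_eq_towerSpace (hW : ∀ n, (W (n + 1)).Refines (W n)) (n : ℕ) :
    (W n).union = towerSpace W := by
  have h : ∀ n, (W n).union = (W 0).union := fun n => by
    induction n with
    | zero => rfl
    | succ n ih => rw [(hW n).union_eq, ih]
  rw [towerSpace, iUnion_congr h, iUnion_const, h n]

theorem measurableSet_towerSpace (W : ℕ → RokhlinTower) : MeasurableSet (towerSpace W) :=
  MeasurableSet.iUnion fun n => (W n).measurableSet_union

theorem levelMod_antitone (hW : ∀ n, (W (n + 1)).Refines (W n)) (j : ℕ) :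
    Antitone fun n => (W n).levelMod j :=
  antitone_nat_of_succ_le fun n => (hW n).levelMod_subset j

theorem volume_towerSpace (hW : ∀ n, (W (n + 1)).Refines (W n)) (n : ℕ) :
    volume (towerSpace W) = (W n).height * ENNReal.ofReal (W n).width := by
  rw [← union_eq_towerSpace hW n, RokhlinTower.volume_union]

theorem volume_towerSpace_ne_zero (hW : ∀ n, (W (n + 1)).Refines (W n)) :
    volume (towerSpace W) ≠ 0 := by
  rw [volume_towerSpace hW 0]
  exact mul_ne_zero (Nat.cast_ne_zero.2 (W 0).height_pos.ne')
    (ENNReal.ofReal_pos.2 (W 0).width_pos).ne'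

theorem volume_towerSpace_ne_top (hW : ∀ n, (W (n + 1)).Refines (W n)) :
    volume (towerSpace W) ≠ ⊤ := by
  rw [volume_towerSpace hW 0]
  exact ENNReal.mul_ne_top (ENNReal.natCast_ne_top _) ENNReal.ofReal_ne_top

theorem inv_volume_mul_width (hW : ∀ n, (W (n + 1)).Refines (W n)) (n : ℕ) :
    (volume (towerSpace W))⁻¹ * ENNReal.ofReal (W n).width = ((W n).height : ENNReal)⁻¹ := by
  have h1 : ((W n).height : ENNReal) ≠ 0 := Nat.cast_ne_zero.2 (W n).height_pos.ne'
  have h2 : ENNReal.ofReal (W n).width ≠ 0 := (ENNReal.ofReal_pos.2 (W n).width_pos).ne'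
  rw [volume_towerSpace hW n, ENNReal.mul_inv (Or.inl h1) (Or.inl (ENNReal.natCast_ne_top _)),
    mul_assoc, ENNReal.inv_mul_cancel h2 ENNReal.ofReal_ne_top, mul_one]

theorem tendsto_width (htop : Tendsto (fun n => volume (W n).top) atTop (𝓝 0)) :
    Tendsto (fun n => (W n).width) atTop (𝓝 0) := by
  have h := (ENNReal.tendsto_toReal ENNReal.zero_ne_top).comp htop
  refine h.congr fun n => ?_
  rw [Function.comp_apply, RokhlinTower.top, RokhlinTower.volume_level,
    ENNReal.toReal_ofReal (W n).width_pos.le]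

theorem tendsto_inv_height (hW : ∀ n, (W (n + 1)).Refines (W n))
    (htop : Tendsto (fun n => volume (W n).top) atTop (𝓝 0)) :
    Tendsto (fun n => ((W n).height : ENNReal)⁻¹) atTop (𝓝 0) := by
  have h := ENNReal.Tendsto.const_mul (a := (volume (towerSpace W))⁻¹) htop
    (Or.inr (ENNReal.inv_ne_top.2 (volume_towerSpace_ne_zero hW)))
  rw [mul_zero] at h
  refine h.congr fun n => ?_
  rw [RokhlinTower.top, RokhlinTower.volume_level, inv_volume_mul_width hW]

theorem normalizedRestriction_levelMod (hW : ∀ n, (W (n + 1)).Refines (W n)) (n k : ℕ) :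
    normalizedRestriction volume (towerSpace W) ((↑) ⁻¹' (W n).levelMod k) =
      ((W n).height : ENNReal)⁻¹ := by
  rw [normalizedRestriction_preimage (measurableSet_towerSpace W), inter_eq_self_of_subset_right
    (union_eq_towerSpace hW n ▸ (W n).levelMod_subset_union k), RokhlinTower.levelMod,
    RokhlinTower.volume_level, inv_volume_mul_width hW]

/-- A probability measure that gives the level sets of each tower equal masses is the normalized
Lebesgue measure. -/
theorem eq_normalizedRestriction_of_levelMod (hW : ∀ n, (W (n + 1)).Refines (W n))
    (htop : Tendsto (fun n => volume (W n).top) atTop (𝓝 0)) (ρ : Measure (towerSpace W))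
    [IsProbabilityMeasure ρ]
    (hρ : ∀ n k, ρ ((↑) ⁻¹' (W n).levelMod k) = ((W n).height : ENNReal)⁻¹) :
    ρ = normalizedRestriction volume (towerSpace W) := by
  have hν := isProbabilityMeasure_normalizedRestriction (m := volume)
    (measurableSet_towerSpace W) (volume_towerSpace_ne_zero hW) (volume_towerSpace_ne_top hW)
  set L : ℕ × ℕ → Set (towerSpace W) := fun p => (↑) ⁻¹' (W p.1).levelMod p.2 with hL
  have hLm : ∀ p, MeasurableSet (L p) := fun p =>
    measurable_subtype_coe ((W _).measurableSet_levelMod _)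
  refine ext_of_generate_finite (range L) (le_antisymm ?_ ?_) ?_ ?_ (by simp)
  · rw [BorelSpace.measurable_eq (α := towerSpace W)]
    refine MeasurableSpace.generateFrom_le fun O (hO : IsOpen O) => ?_
    -- The widths tend to `0`, so levels fit inside any neighbourhood; there are countably many of
    -- them.
    have hOeq : O = ⋃ p, ⋃ (_ : L p ⊆ O), L p := by
      refine subset_antisymm (fun y hy => ?_) (iUnion₂_subset fun p hp => hp)
      obtain ⟨δ, hδ, hball⟩ := Metric.isOpen_iff.1 hO y hy
      obtain ⟨n, hn⟩ := ((tendsto_width htop).eventually_lt_const hδ).exists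
      have hy' : (y : ℝ) ∈ (W n).union := (union_eq_towerSpace hW n).symm ▸ y.prop
      obtain ⟨k, hk⟩ := (W n).exists_mem_levelMod hy'
      refine mem_iUnion₂.2 ⟨(n, k), fun z hz => hball ?_, hk⟩
      have hz' : (z : ℝ) ∈ (W n).levelMod k := hz
      rw [RokhlinTower.levelMod_eq_Ico, mem_Ico] at hz' hk
      rw [Metric.mem_ball, Subtype.dist_eq, Real.dist_eq, abs_lt]
      constructor <;> linarith
    rw [hOeq]
    exact MeasurableSet.iUnion fun p => MeasurableSet.iUnion fun _ =>
      MeasurableSpace.measurableSet_generateFrom (mem_range_self p)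
  · exact MeasurableSpace.generateFrom_le (forall_mem_range.2 hLm)
  -- Two levels are nested or disjoint, so they form a π-system.
  · have key : ∀ p q : ℕ × ℕ, p.1 ≤ q.1 → (L p ∩ L q).Nonempty → L p ∩ L q = L q := by
      rintro ⟨n, k⟩ ⟨n', k'⟩ hle ⟨x, hx, hx'⟩
      have h1 := levelMod_antitone hW k' hle
      have h2 := (W n).levelMod_congr ((W n).modEq_of_mem_levelMod hx (h1 hx'))
      refine inter_eq_self_of_subset_right fun y hy => ?_
      change (y : ℝ) ∈ (W n).levelMod k
      rw [h2]
      exact h1 hy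
    rintro _ ⟨p, rfl⟩ _ ⟨q, rfl⟩ hne
    rcases le_total p.1 q.1 with h | h
    · exact ⟨q, (key p q h hne).symm⟩
    · rw [inter_comm] at hne ⊢
      exact ⟨p, (key q p h hne).symm⟩
  · rintro _ ⟨p, rfl⟩
    rw [hL, hρ, normalizedRestriction_levelMod hW]

theorem levelMod_subset_of_compatible (hW : ∀ n, (W (n + 1)).Refines (W n)) {a : ℕ → ℕ}
    (ha : ∀ n, a (n + 1) ≡ a n [MOD (W n).height]) :
    Antitone fun n => (W n).levelMod (a n) :=
  antitone_nat_of_succ_le fun n => by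
    rw [← (W n).levelMod_congr (ha n)]
    exact (hW n).levelMod_subset _

theorem bounds_of_compatible (hW : ∀ n, (W (n + 1)).Refines (W n)) {a : ℕ → ℕ}
    (ha : ∀ n, a (n + 1) ≡ a n [MOD (W n).height]) {n k : ℕ} (h : n ≤ k) :
    (W n).leftMod (a n) ≤ (W k).leftMod (a k) ∧
      (W k).leftMod (a k) + (W k).width ≤ (W n).leftMod (a n) + (W n).width := by
  have h1 := levelMod_subset_of_compatible hW ha h
  simp only [RokhlinTower.levelMod_eq_Ico] at h1
  exact (Ico_subset_Ico_iff (lt_add_of_pos_right _ (W k).width_pos)).1 h1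

/-- The closed interval is the best available here: the supremum may be the missing right endpoint.
-/
theorem iSup_leftMod_mem_Icc (hW : ∀ n, (W (n + 1)).Refines (W n)) {a : ℕ → ℕ}
    (ha : ∀ n, a (n + 1) ≡ a n [MOD (W n).height]) (n : ℕ) :
    ⨆ i, (W i).leftMod (a i) ∈
      Icc ((W n).leftMod (a n)) ((W n).leftMod (a n) + (W n).width) := by
  have hub : ∀ i, (W i).leftMod (a i) ≤ (W n).leftMod (a n) + (W n).width := fun i => by
    have h1 := bounds_of_compatible hW ha (le_max_left i n)
    have h2 := bounds_of_compatible hW ha (le_max_right i n)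
    have h3 := (W (max i n)).width_pos
    linarith [h1.1, h2.2]
  exact ⟨le_ciSup (f := fun i => (W i).leftMod (a i)) ⟨_, forall_mem_range.2 hub⟩ n, ciSup_le hub⟩

end NestedTowers

/-! ### Cyclic factors and the odometer -/

section Factor

variable {Z : Type*} [MeasurableSpace Z] {μ : Measure Z} {S : Z → Z}

/-- The law of a cyclic factor is uniform. -/
theorem measure_modEq_of_step [IsProbabilityMeasure μ] (hS : MeasurePreserving S μ μ) {f : Z → ℕ} (hf : Measurable f)
    {H : ℕ} (hH : 0 < H) (hstep : ∀ᵐ z ∂μ, f (S z) ≡ f z + 1 [MOD H]) (k : ℕ) :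
    μ {z | f z ≡ k [MOD H]} = (H : ENNReal)⁻¹ := by
  have hm : ∀ k, MeasurableSet {z | f z ≡ k [MOD H]} := fun k =>
    hf (MeasurableSet.of_discrete (s := {i | i ≡ k [MOD H]}))
  -- The preimage of class `k + 1` under `S` is class `k`, so all classes have equal mass.
  have hconst : ∀ k, μ {z | f z ≡ k [MOD H]} = μ {z | f z ≡ 0 [MOD H]} := fun k => by
    induction k with
    | zero => rfl
    | succ k ih =>
      rw [← ih, ← hS.measure_preimage (hm (k + 1)).nullMeasurableSet]
      refine measure_congr ?_
      filter_upwards [hstep] with z hz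
      refine propext ⟨fun h : f (S z) ≡ k + 1 [MOD H] => ?_, fun h : f z ≡ k [MOD H] => ?_⟩
      · exact Nat.ModEq.add_right_cancel' 1 (hz.symm.trans h)
      · exact hz.trans (h.add_right 1)
  have hsum : μ (⋃ k ∈ Finset.range H, {z | f z ≡ k [MOD H]}) =
      ∑ k ∈ Finset.range H, μ {z | f z ≡ k [MOD H]} := by
    refine measure_biUnion_finset (fun i hi j hj hij => ?_) fun k _ => hm k
    refine Set.disjoint_left.2 fun z (hz : f z ≡ i [MOD H]) (hz' : f z ≡ j [MOD H]) => hij ?_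
    exact (hz.symm.trans hz').eq_of_lt_of_lt (Finset.mem_range.1 hi) (Finset.mem_range.1 hj)
  have huniv : (⋃ k ∈ Finset.range H, {z | f z ≡ k [MOD H]}) = univ :=
    eq_univ_of_forall fun z => mem_iUnion₂.2
      ⟨f z % H, Finset.mem_range.2 (Nat.mod_lt _ hH), (Nat.mod_modEq _ _).symm⟩
  rw [huniv, measure_univ, Finset.sum_congr rfl fun k _ => hconst k, Finset.sum_const,
    Finset.card_range, nsmul_eq_mul, mul_comm] at hsum
  rw [hconst k]
  exact ENNReal.eq_inv_of_mul_eq_one_left hsum.symm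

variable {W : ℕ → RokhlinTower}

/-- Almost every itinerary determines a point: the limit point lies in all half-open levels. -/
theorem ae_iSup_leftMod_mem_levelMod (hW : ∀ n, (W (n + 1)).Refines (W n))
    (htop : Tendsto (fun n => volume (W n).top) atTop (𝓝 0)) {f : ℕ → Z → ℕ}
    (hunif : ∀ n k, μ {z | f n z ≡ k [MOD (W n).height]} = ((W n).height : ENNReal)⁻¹)
    (hcompat : ∀ᵐ z ∂μ, ∀ n, f (n + 1) z ≡ f n z [MOD (W n).height]) :
    ∀ᵐ z ∂μ, ∀ n, ⨆ i, (W i).leftMod (f i z) ∈ (W n).levelMod (f n z) := by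
  set p : Z → ℝ := fun z => ⨆ i, (W i).leftMod (f i z) with hp
  set E : ℕ → ℕ → Set Z := fun n k => {z | (∀ n, f (n + 1) z ≡ f n z [MOD (W n).height]) ∧
    f n z ≡ k [MOD (W n).height] ∧ p z = (W n).leftMod k + (W n).width} with hE
  have hleft : ∀ n {j k : ℕ}, j ≡ k [MOD (W n).height] → (W n).leftMod j = (W n).leftMod k :=
    fun n j k (h : j % _ = k % _) => by simp only [RokhlinTower.leftMod, h]
  -- On the bad set every later level is the rightmost piece of level `k`, so its label modulo the
  -- height is determined. The bad set thus has measure at most the inverse of each later height.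
  have hend : ∀ n k m, n ≤ m → ∀ z ∈ E n k,
      (W m).leftMod (f m z) = (W n).leftMod k + (W n).width - (W m).width := by
    rintro n k m hnm z ⟨hc, hk, hz⟩
    have h1 := (bounds_of_compatible hW (a := fun i => f i z) hc hnm).2
    have h2 := (iSup_leftMod_mem_Icc hW (a := fun i => f i z) hc m).2
    rw [hleft n hk] at h1
    have h3 : (⨆ i, (W i).leftMod (f i z)) = (W n).leftMod k + (W n).width := hz
    rw [h3] at h2
    linarith
  have hnull : ∀ n k, μ (E n k) = 0 := fun n k => by
    have hle : ∀ m, n ≤ m → μ (E n k) ≤ ((W m).height : ENNReal)⁻¹ := fun m hnm => by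
      rcases (E n k).eq_empty_or_nonempty with he | ⟨z₀, hz₀⟩
      · rw [he, measure_empty]; exact zero_le
      · rw [← hunif m (f m z₀)]
        refine measure_mono fun z hz => (W m).modEq_of_mem_levelMod
          ((W m).leftMod_mem_levelMod _) ?_
        rw [hend n k m hnm z hz, ← hend n k m hnm z₀ hz₀]
        exact (W m).leftMod_mem_levelMod _
    exact le_antisymm (ge_of_tendsto (tendsto_inv_height hW htop)
      (eventually_atTop.2 ⟨n, hle⟩)) zero_le
  have hout : ∀ᵐ z ∂μ, ∀ n k, z ∉ E n k :=
    ae_all_iff.2 fun n => ae_all_iff.2 fun k => measure_eq_zero_iff_ae_notMem.1 (hnull n k)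
  filter_upwards [hcompat, hout] with z hc hz n
  have h := iSup_leftMod_mem_Icc hW (a := fun i => f i z) hc n
  exact ⟨h.1, h.2.lt_of_ne fun heq => hz n (f n z) ⟨hc, rfl, heq⟩⟩

/-- A probability preserving transformation with a compatible sequence of cyclic factors, whose
orders are the heights of the towers of an odometer, has this odometer as a factor. -/
theorem IsOdometer.isFactorPPT [IsProbabilityMeasure μ]
    {R : towerSpace W → towerSpace W} (hR : IsOdometer W R) (hS : MeasurePreserving S μ μ) {f : ℕ → Z → ℕ} (hf : ∀ n, Measurable (f n))
    (hstep : ∀ n, ∀ᵐ z ∂μ, f n (S z) ≡ f n z + 1 [MOD (W n).height])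
    (hcompat : ∀ n, ∀ᵐ z ∂μ, f (n + 1) z ≡ f n z [MOD (W n).height]) :
    IsFactorPPT R (normalizedRestriction volume (towerSpace W)) S μ := by
  have hW := hR.nested
  have hunif := fun n => measure_modEq_of_step hS (hf n) (W n).height_pos (hstep n)
  have hmem := ae_iSup_leftMod_mem_levelMod hW hR.top_tendsto hunif (ae_all_iff.2 hcompat)
  have hν := isProbabilityMeasure_normalizedRestriction (m := volume)
    (measurableSet_towerSpace W) (volume_towerSpace_ne_zero hW) (volume_towerSpace_ne_top hW)
  have hlevel : ∀ n k, (W n).levelMod k ⊆ towerSpace W := fun n k =>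
    union_eq_towerSpace hW n ▸ (W n).levelMod_subset_union k
  set p : Z → ℝ := fun z => ⨆ i, (W i).leftMod (f i z) with hp
  have hpm : Measurable p := Measurable.iSup fun i =>
    (measurable_of_countable (W i).leftMod).comp (hf i)
  classical
  -- The value outside `towerSpace W` is an arbitrary point of it, used on a null set only.
  set q : Z → ℝ := fun z => if p z ∈ towerSpace W then p z else (W 0).leftMod 0 with hq
  have hqm : Measurable q :=
    Measurable.ite (hpm (measurableSet_towerSpace W)) hpm measurable_const
  have hqmem : ∀ z, q z ∈ towerSpace W := fun z => by
    by_cases h : p z ∈ towerSpace W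
    · simpa only [hq, if_pos h] using h
    · simpa only [hq, if_neg h] using hlevel 0 0 ((W 0).leftMod_mem_levelMod 0)
  set π : Z → towerSpace W := fun z => ⟨q z, hqmem z⟩ with hπ
  have hπm : Measurable π := hqm.subtype_mk
  have hπmem : ∀ᵐ z ∂μ, ∀ n, (π z : ℝ) ∈ (W n).levelMod (f n z) := by
    filter_upwards [hmem] with z hz n
    have : (π z : ℝ) = p z := if_pos (hlevel 0 _ (hz 0))
    rw [this]
    exact hz n
  have hπp : MeasurePreserving π μ (normalizedRestriction volume (towerSpace W)) := by
    have := Measure.isProbabilityMeasure_map (μ := μ) hπm.aemeasurable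
    refine ⟨hπm, eq_normalizedRestriction_of_levelMod hW hR.top_tendsto _ fun n k => ?_⟩
    rw [Measure.map_apply hπm (measurable_subtype_coe ((W _).measurableSet_levelMod _)),
      ← hunif n k]
    refine measure_congr ?_
    filter_upwards [hπmem] with z hz
    refine propext ⟨fun h => (W n).modEq_of_mem_levelMod (hz n) h, fun h => ?_⟩
    have hzn := hz n
    rw [(W n).levelMod_congr h] at hzn
    exact hzn
  have hequi : π ∘ S =ᵐ[μ] R ∘ π := by
    filter_upwards [hπmem, hS.quasiMeasurePreserving.ae hπmem, ae_all_iff.2 hstep,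
      hπp.quasiMeasurePreserving.ae hR.ae_tendsto] with z hz hSz hst hlim
    -- `π (S z)` and the image of `π z` under the `n`-th periodic map share a level, so they are
    -- within its width.
    refine Subtype.ext (tendsto_nhds_unique (f := fun n => (W n).periodicMap (π z : ℝ)) ?_ hlim)
    rw [tendsto_iff_dist_tendsto_zero]
    refine squeeze_zero (fun _ => dist_nonneg) (fun n => ?_) (tendsto_width hR.top_tendsto)
    have h1 := (W n).periodicMap_mem_levelMod (hz n)
    have h2 := hSz n
    rw [(W n).levelMod_congr (hst n)] at h2
    rw [RokhlinTower.levelMod_eq_Ico, mem_Ico] at h1 h2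
    rw [Function.comp_apply, Real.dist_eq, abs_le]
    constructor <;> linarith
  refine ⟨hν, ⟨hR.measurable, ?_⟩, inferInstance, hS, π, hπp, hequi⟩
  -- Invariance under `R` is not part of `IsOdometer`; it is transported from `S` through `π`.
  conv_lhs => rw [← hπp.map_eq]
  rw [Measure.map_map hR.measurable hπm, ← Measure.map_congr hequi,
    ← Measure.map_map hπm hS.measurable, hS.map_eq, hπp.map_eq]

end Factor

theorem mainTheorem7
    (W : ℕ → RokhlinTower) (R : towerSpace W → towerSpace W) (hR : IsOdometer W R)
    {X : Type*} [MeasurableSpace X] [MeasurableSpace.CountablySeparated X]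
    (m : Measure X) [IsProbabilityMeasure m]
    (T : X → X) (hT : MeasurePreserving T m m) (hap : IsAperiodic T m) :
    ∃ Ω : Set X, MeasurableSet Ω ∧ 0 < m Ω ∧
      IsFactorPPT R (normalizedRestriction volume (towerSpace W))
        (inducedMap T Ω) (normalizedRestriction m Ω) := by
  obtain ⟨Ω, hΩ, hpos, f, hf, hcompat⟩ := exists_compatible_cyclicLabels hT hap
    (H := fun n => (W n).height) (fun n => (W n).height_pos) fun n => (hR.nested n).height_dvd
  have := isProbabilityMeasure_normalizedRestriction (m := m) hΩ hpos.ne' (measure_ne_top m Ω)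
  exact ⟨Ω, hΩ, hpos, hR.isFactorPPT (measurePreserving_inducedMap hT hΩ)
    (f := fun n x => f n x) (fun n => (hf n).measurable.comp measurable_subtype_coe)
    (fun n => ae_normalizedRestriction hΩ (hf n).step)
    (fun n => ae_normalizedRestriction hΩ (hcompat n))⟩
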